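/- Let $G$ be a finite simple graph. A set $M\subseteq V(G)$ is a mutual-visibility set if for any two vertices $u,v\in M$ there is a shortest $u$-$v$ path in $G$ none of whose internal vertices lies in $M$. Let $\chi_\mu(G)$ be the least number of colors in a coloring of $V(G)$ such that every color class is a mutual-visibility set. For $n\in\mathbb{N}$, let $Q_n$ be the $n$-dimensional hypercube, that is, the graph whose vertices are the subsets of $\{1,\dots,n\}$, where two subsets $A,B$ are adjacent if and only if $|A\,\triangle\,B|=1$. Theorem. As $n\to\infty$, $\chi_\mu(Q_n)=\omega(1)$, that is, $\chi_\mu(Q_n)\to\infty$, and $\chi_\mu(Q_n)=O(\log_2\log_2 n)$, that is, there are constants $K$ and $n_0$ such that $\chi_\mu(Q_n)\le K\log_2\log_2 n$ for all $n\ge n_0$. In particular, there is no absolute constant $C>0$ such that $\chi_\mu(Q_n)\le C$ for all $n\in\mathbb{N}$. -/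

import Mathlib

/-- A set `M` of vertices of `G` is a mutual-visibility set if any two vertices `u, v ∈ M` are
joined by a shortest path of `G` none of whose internal vertices lies in `M`.
(For `u = v` the trivial path always works.) -/
def SimpleGraph.IsMutualVisibilitySet {V : Type*} (G : SimpleGraph V) (M : Set V) : Prop :=
  ∀ u ∈ M, ∀ v ∈ M, ∃ p : G.Walk u v, p.IsPath ∧ p.length = G.dist u v ∧
    ∀ w ∈ p.support, w ≠ u → w ≠ v → w ∉ M

/-- The vertices of `G` can be coloured with `q` colours so that each colour class is a
mutual-visibility set. -/
def SimpleGraph.MutualVisibilityColorable {V : Type*} (G : SimpleGraph V) (q : ℕ) : Prop :=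
  ∃ c : V → Fin q, ∀ i : Fin q, G.IsMutualVisibilitySet {v | c v = i}

/-- The mutual-visibility chromatic number of a finite graph `G`: the least number of colours in a
colouring of the vertices all of whose colour classes are mutual-visibility sets. -/
noncomputable def SimpleGraph.mutualVisibilityChromaticNumber {V : Type*} [Finite V]
    (G : SimpleGraph V) : ℕ :=
  sInf {q : ℕ | G.MutualVisibilityColorable q}

/-- On a finite graph some number of colours suffices, so the infimum above is a minimum. -/
theorem SimpleGraph.mutualVisibilityColorable_chromaticNumber {V : Type*} [Finite V]
    (G : SimpleGraph V) :
    G.MutualVisibilityColorable G.mutualVisibilityChromaticNumber := by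
  refine Nat.sInf_mem (s := {q : ℕ | G.MutualVisibilityColorable q})
    ⟨Nat.card V, Finite.equivFin V, fun i u hu v hv => ?_⟩
  obtain rfl : u = v := (Finite.equivFin V).injective (hu.trans hv.symm)
  exact ⟨.nil, by simp, by simp, by simp⟩

/-- The `n`-dimensional hypercube: the vertices are the subsets of an `n`-element set, and two of
them are adjacent if and only if their symmetric difference has exactly one element. -/
def hypercube (n : ℕ) : SimpleGraph (Finset (Fin n)) where
  Adj A B := (symmDiff A B).card = 1
  symm := ⟨fun A B h => by rwa [symmDiff_comm]⟩
  loopless := ⟨fun A h => by simp at h⟩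

-- Geodesics of the cube and a criterion for mutual visibility.

section Hypercube

variable {n : ℕ} {A B X Y : Finset (Fin n)} {M : Set (Finset (Fin n))}

-- Lower bound: by Ramsey, for large `n` some set `T` of `2q + 1` points has all its subsets of size
-- at most `2q` coloured by size alone. Three sizes `i < j < l` share a colour. A geodesic between
-- nested subsets of `T` of sizes `i` and `l` stays inside the larger one and crosses layer `j`,
-- hence is blocked.
--
-- Upper bound: colour `X` by `|X| mod t` and one extra bit. Layers between congruent ones are free
-- for travel, so a geodesic only needs an unoccupied set of each intermediate congruent layer;
-- `isMutualVisibilitySet_of_middle` reduces this to the bit being non-constant on the middle layer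
-- of every interval of length `2t`. A random bit for each vertex would need a union bound over
-- exponentially many intervals. Instead the bit is a function of the first `2t` power sums of `X`
-- over a field of `p ≤ 2n` elements. These are additive on disjoint unions and separate `t`-sets,
-- so a middle layer yields `centralBinom t` distinct vectors, while only `(2n)^(2t) * n^(2t)`
-- vector families occur. Thus `t` of order `log log n` suffices.

lemma card_symmDiff_le_length (p : (hypercube n).Walk A B) :
    (symmDiff A B).card ≤ p.length := by
  induction p with
  | nil => simp
  | @cons A C B h p ih =>
    have h1 : (symmDiff A C).card = 1 := h
    have h2 : (symmDiff A B).card ≤ (symmDiff A C ∪ symmDiff C B).card :=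
      Finset.card_le_card (symmDiff_triangle A C B)
    have h3 := Finset.card_union_le (symmDiff A C) (symmDiff C B)
    rw [SimpleGraph.Walk.length_cons]
    omega

lemma hypercube_adj_insert {y : Fin n} (hy : y ∉ A) : (hypercube n).Adj A (insert y A) := by
  change (symmDiff A (insert y A)).card = 1
  rw [Finset.card_eq_one]
  exact ⟨y, by ext; simp only [Finset.mem_symmDiff]; grind⟩

lemma hypercube_adj_erase {x : Fin n} (hx : x ∈ A) : (hypercube n).Adj A (A.erase x) := by
  change (symmDiff A (A.erase x)).card = 1
  rw [Finset.card_eq_one]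
  exact ⟨x, by ext; simp only [Finset.mem_symmDiff]; grind⟩

lemma card_symmDiff_insert_left {y : Fin n} (hyB : y ∈ B) (hyA : y ∉ A) :
    (symmDiff (insert y A) B).card + 1 = (symmDiff A B).card := by
  have h : symmDiff (insert y A) B = (symmDiff A B).erase y := by
    ext; simp only [Finset.mem_symmDiff, Finset.mem_erase]; grind
  rw [h, Finset.card_erase_add_one]
  simp [Finset.mem_symmDiff, hyA, hyB]

lemma card_symmDiff_erase_left {x : Fin n} (hxA : x ∈ A) (hxB : x ∉ B) :
    (symmDiff (A.erase x) B).card + 1 = (symmDiff A B).card := by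
  have h : symmDiff (A.erase x) B = (symmDiff A B).erase x := by
    ext; simp only [Finset.mem_symmDiff, Finset.mem_erase]; grind
  rw [h, Finset.card_erase_add_one]
  simp [Finset.mem_symmDiff, hxA, hxB]

/-- Two vertices of the cube whose sizes lie in an interval with at least two elements are joined
by a shortest path along which the sizes stay in that interval. -/
lemma exists_walk_card_mem_Icc {lo hi : ℕ} (hlh : lo < hi) (hA : A.card ∈ Set.Icc lo hi)
    (hB : B.card ∈ Set.Icc lo hi) :
    ∃ p : (hypercube n).Walk A B, p.length = (symmDiff A B).card ∧
      ∀ W ∈ p.support, W.card ∈ Set.Icc lo hi := by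
  induction hd : (symmDiff A B).card generalizing A with
  | zero =>
    obtain rfl : A = B := by simpa using hd
    exact ⟨.nil, by simp, by simpa using hA⟩
  | succ d ih =>
    have step : ∀ C : Finset (Fin n), (hypercube n).Adj A C → C.card ∈ Set.Icc lo hi →
        (symmDiff C B).card + 1 = (symmDiff A B).card →
        ∃ p : (hypercube n).Walk A B, p.length = d + 1 ∧
          ∀ W ∈ p.support, W.card ∈ Set.Icc lo hi := by
      intro C hAC hC hCB
      obtain ⟨p, hp, hps⟩ := ih hC (by omega)
      refine ⟨.cons hAC p, by simp [hp], fun W hW => ?_⟩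
      rw [SimpleGraph.Walk.support_cons, List.mem_cons] at hW
      rcases hW with rfl | hW
      exacts [hA, hps W hW]
    simp only [Set.mem_Icc] at hA hB step
    -- Delete a point of `A \ B` while above the bottom layer. At the bottom `|A| ≤ |B|`, so a point
    -- of `B \ A` can be added, and `lo < hi` leaves room for it.
    by_cases hAB : ∃ x ∈ A, x ∉ B
    · obtain ⟨x, hxA, hxB⟩ := hAB
      by_cases hlo : lo < A.card
      · exact step _ (hypercube_adj_erase hxA) (by rw [Finset.card_erase_of_mem hxA]; omega)
          (card_symmDiff_erase_left hxA hxB)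
      · obtain ⟨y, hyB, hyA⟩ : ∃ y ∈ B, y ∉ A := by
          by_contra! h
          have := Finset.eq_of_subset_of_card_le h (by omega)
          exact hxB (this ▸ hxA)
        exact step _ (hypercube_adj_insert hyA) (by rw [Finset.card_insert_of_notMem hyA]; omega)
          (card_symmDiff_insert_left hyB hyA)
    · push Not at hAB
      obtain ⟨y, hyB, hyA⟩ : ∃ y ∈ B, y ∉ A := by
        by_contra! h
        have : A = B := Finset.Subset.antisymm hAB h
        simp [this] at hd
      have hlt : A.card < B.card := Finset.card_lt_card ⟨hAB, fun h => hyA (h hyB)⟩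
      exact step _ (hypercube_adj_insert hyA) (by rw [Finset.card_insert_of_notMem hyA]; omega)
        (card_symmDiff_insert_left hyB hyA)

lemma exists_walk_length_eq_card_symmDiff (A B : Finset (Fin n)) :
    ∃ p : (hypercube n).Walk A B, p.length = (symmDiff A B).card := by
  -- The bound is `n + 1`, not `n`, so that the interval is nondegenerate when `n = 0`.
  have hle : ∀ C : Finset (Fin n), C.card ∈ Set.Icc 0 (n + 1) := fun C =>
    ⟨Nat.zero_le _, (card_finset_fin_le C).trans (Nat.le_succ n)⟩
  obtain ⟨p, hp, -⟩ := exists_walk_card_mem_Icc (Nat.succ_pos n) (hle A) (hle B)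
  exact ⟨p, hp⟩

lemma hypercube_dist (A B : Finset (Fin n)) :
    (hypercube n).dist A B = (symmDiff A B).card := by
  obtain ⟨p, hp⟩ := exists_walk_length_eq_card_symmDiff A B
  obtain ⟨q, hq⟩ := p.reachable.exists_walk_length_eq_dist
  exact le_antisymm (hp ▸ SimpleGraph.dist_le p) (hq ▸ card_symmDiff_le_length q)

/-- `A` and `B` are joined by a shortest path with no internal vertex in `M`. -/
def CubeVisible (M : Set (Finset (Fin n))) (A B : Finset (Fin n)) : Prop :=
  ∃ p : (hypercube n).Walk A B, p.length = (symmDiff A B).card ∧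
    ∀ W ∈ p.support, W ≠ A → W ≠ B → W ∉ M

lemma CubeVisible.symm (h : CubeVisible M A B) : CubeVisible M B A := by
  obtain ⟨p, hp, hM⟩ := h
  refine ⟨p.reverse, by rw [SimpleGraph.Walk.length_reverse, hp, symmDiff_comm], ?_⟩
  intro W hW hB hA
  exact hM W (by simpa using hW) hA hB

lemma CubeVisible.trans (h₁ : CubeVisible M A Y) (h₂ : CubeVisible M Y B) (hY : Y ∉ M)
    (hd : (symmDiff A Y).card + (symmDiff Y B).card = (symmDiff A B).card) :
    CubeVisible M A B := by
  obtain ⟨p, hp, hpM⟩ := h₁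
  obtain ⟨q, hq, hqM⟩ := h₂
  refine ⟨p.append q, by rw [SimpleGraph.Walk.length_append]; omega, fun W hW hA hB => ?_⟩
  rcases eq_or_ne W Y with rfl | hWY
  · exact hY
  · rw [SimpleGraph.Walk.mem_support_append_iff] at hW
    exact hW.elim (fun h => hpM W h hA hWY) (fun h => hqM W h hWY hB)

lemma CubeVisible.of_adj (h : (hypercube n).Adj A B) : CubeVisible M A B := by
  refine ⟨h.toWalk, by simpa using (show (symmDiff A B).card = 1 from h).symm, ?_⟩
  intro W hW hA hB
  simp at hW
  tauto

lemma CubeVisible.of_card_mem_Icc {lo hi : ℕ} (hlh : lo < hi) (hA : A.card ∈ Set.Icc lo hi)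
    (hB : B.card ∈ Set.Icc lo hi) (hM : ∀ W ∈ M, W.card ∉ Set.Icc lo hi) :
    CubeVisible M A B := by
  obtain ⟨p, hp, hps⟩ := exists_walk_card_mem_Icc hlh hA hB
  exact ⟨p, hp, fun W hW _ _ hWM => hM W hWM (hps W hW)⟩

lemma isMutualVisibilitySet_of_cubeVisible (h : ∀ A ∈ M, ∀ B ∈ M, CubeVisible M A B) :
    (hypercube n).IsMutualVisibilitySet M := by
  intro A hA B hB
  obtain ⟨p, hp, hpM⟩ := h A hA B hB
  have hd : p.length = (hypercube n).dist A B := by rw [hp, hypercube_dist]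
  exact ⟨p, p.isPath_of_length_eq_dist hd, hd, hpM⟩

/-- Step from `A` to `C`, move to `D` within the sizes between `lo` and `hi`, and step to `B`. -/
lemma CubeVisible.of_corridor {C D : Finset (Fin n)} {lo hi : ℕ} (hlh : lo < hi)
    (hAC : (hypercube n).Adj A C) (hDB : (hypercube n).Adj D B)
    (hC : C.card ∈ Set.Icc lo hi) (hD : D.card ∈ Set.Icc lo hi)
    (hM : ∀ W ∈ M, W.card ∉ Set.Icc lo hi)
    (h₁ : (symmDiff C B).card + 1 = (symmDiff A B).card)
    (h₂ : (symmDiff C D).card + 1 = (symmDiff C B).card) :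
    CubeVisible M A B := by
  have hAC' : (symmDiff A C).card = 1 := hAC
  have hDB' : (symmDiff D B).card = 1 := hDB
  refine (CubeVisible.of_adj hAC).trans (Y := C) ?_ (fun h => hM C h hC) (by omega)
  exact (CubeVisible.of_card_mem_Icc hlh hC hD hM).trans (.of_adj hDB) (fun h => hM D h hD)
    (by omega)

variable {t r : ℕ}

lemma notMem_Icc_of_mod_eq {a b hi : ℕ} (hhi : hi < a + t) (h : b % t = a % t) :
    b ∉ Set.Icc (a + 1) hi := by
  rintro ⟨h1, h2⟩
  have hdvd := (Nat.modEq_iff_dvd' (by omega : a ≤ b)).mp (Eq.symm h)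
  have := Nat.le_of_dvd (by omega) hdvd
  omega

/-- The `t - 1 ≥ 2` layers strictly between form a corridor free of `M`: add `y` first and `z` last.
-/
lemma CubeVisible.of_card_eq_add (ht : 3 ≤ t) (hM : ∀ W ∈ M, W.card % t = r)
    (hA : A.card % t = r) (hAB : B.card = A.card + t) : CubeVisible M A B := by
  have h2 : 1 < (B \ A).card := by have := Finset.le_card_sdiff A B; omega
  obtain ⟨y, hy, z, hz, hyz⟩ := Finset.one_lt_card.mp h2
  rw [Finset.mem_sdiff] at hy hz
  have hcard : ∀ W ∈ M, W.card ∉ Set.Icc (A.card + 1) (A.card + t - 1) :=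
    fun W hW => notMem_Icc_of_mod_eq (by omega) ((hM W hW).trans hA.symm)
  refine CubeVisible.of_corridor (C := insert y A) (D := B.erase z) (lo := A.card + 1)
    (hi := A.card + t - 1) (by omega) (hypercube_adj_insert hy.2)
    (hypercube_adj_erase hz.1).symm ?_ ?_ hcard (card_symmDiff_insert_left hy.1 hy.2) ?_
  · rw [Finset.card_insert_of_notMem hy.2]; constructor <;> omega
  · rw [Finset.card_erase_of_mem hz.1]; constructor <;> omega
  · rw [symmDiff_comm _ (B.erase z), symmDiff_comm _ B]
    exact card_symmDiff_erase_left hz.1 (by simp [hz.2, hyz.symm])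

/-- The two layers above are free of `M`, as `t ≥ 3`: add `y` first and delete `x` last. -/
lemma CubeVisible.of_card_eq (ht : 3 ≤ t) (hM : ∀ W ∈ M, W.card % t = r)
    (hA : A.card % t = r) (hAB : B.card = A.card) : CubeVisible M A B := by
  rcases eq_or_ne A B with rfl | hne
  · exact ⟨.nil, by simp, by simp⟩
  obtain ⟨y, hyB, hyA⟩ : ∃ y ∈ B, y ∉ A := by
    by_contra! h
    exact hne (Finset.eq_of_subset_of_card_le h hAB.ge).symm
  obtain ⟨x, hxA, hxB⟩ : ∃ x ∈ A, x ∉ B := by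
    by_contra! h
    exact hne (Finset.eq_of_subset_of_card_le h hAB.le)
  have hcard : ∀ W ∈ M, W.card ∉ Set.Icc (A.card + 1) (A.card + 2) :=
    fun W hW => notMem_Icc_of_mod_eq (by omega) ((hM W hW).trans hA.symm)
  refine CubeVisible.of_corridor (C := insert y A) (D := insert x B) (lo := A.card + 1)
    (hi := A.card + 2) (by omega) (hypercube_adj_insert hyA)
    (hypercube_adj_insert hxB).symm ?_ ?_ hcard (card_symmDiff_insert_left hyB hyA) ?_
  · rw [Finset.card_insert_of_notMem hyA]; constructor <;> omega
  · rw [Finset.card_insert_of_notMem hxB]; constructor <;> omega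
  · rw [symmDiff_comm _ (insert x B), symmDiff_comm _ B]
    exact card_symmDiff_insert_left (by simp [hxA]) hxB

/-- A set of vertices in the layers congruent to `r` modulo `t` is a mutual-visibility set as soon
as between any two nested vertices `2 * t` layers apart its middle layer is not full. -/
lemma isMutualVisibilitySet_of_middle (ht : 3 ≤ t) (hM : ∀ W ∈ M, W.card % t = r)
    (hmid : ∀ A B : Finset (Fin n), A ⊆ B → B.card = A.card + 2 * t → A.card % t = r →
      ∃ X, A ⊆ X ∧ X ⊆ B ∧ X.card = A.card + t ∧ X ∉ M) :
    (hypercube n).IsMutualVisibilitySet M := by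
  -- The ends need not lie in `M`: the induction restarts from a set `X ∉ M`.
  have key : ∀ k : ℕ, ∀ A B : Finset (Fin n), A.card % t = r → B.card = A.card + k * t →
      CubeVisible M A B := by
    intro k
    induction k with
    | zero => intro A B hA hB; exact .of_card_eq ht hM hA (by simpa using hB)
    | succ k ih =>
      intro A B hA hB
      rcases Nat.eq_zero_or_pos k with rfl | hk
      · exact .of_card_eq_add ht hM hA (by simpa using hB)
      have hkt : t ≤ k * t := Nat.le_mul_of_pos_left t hk
      rw [Nat.succ_mul] at hB
      -- `A` need not lie in `B`, so it is replaced by `A'` of the same size with `A ∩ B ⊆ A' ⊆ B`.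
      -- Any `X` between `A ∩ B` and `B` is on a geodesic from `A` to `B`.
      obtain ⟨A', hA', hA'B, hA'c⟩ := Finset.exists_subsuperset_card_eq
        (Finset.inter_subset_right (s₁ := A) (s₂ := B)) (n := A.card)
        (Finset.card_le_card Finset.inter_subset_left) (by omega)
      obtain ⟨B', hB', hB'B, hB'c⟩ := Finset.exists_subsuperset_card_eq
        hA'B (n := A.card + 2 * t) (by omega) (by omega)
      obtain ⟨X, hAX, hXB, hXc, hXM⟩ := hmid A' B' hB' (by omega) (by rw [hA'c, hA])
      have hXB := hXB.trans hB'B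
      have hAX := hA'.trans hAX
      refine (CubeVisible.of_card_eq_add ht hM hA (by omega)).trans
        (ih X B (by rw [hXc, hA'c, Nat.add_mod_right, hA]) (by omega)) hXM ?_
      rw [← Finset.card_union_of_disjoint]
      · congr 1
        ext a
        have h1 := @hXB a
        have h2 := @hAX a
        simp only [Finset.mem_union, Finset.mem_symmDiff, Finset.mem_inter] at *
        tauto
      · rw [Finset.disjoint_left]
        intro a
        have h1 := @hXB a
        have h2 := @hAX a
        simp only [Finset.mem_symmDiff, Finset.mem_inter] at *
        tauto
  have main : ∀ A ∈ M, ∀ B ∈ M, A.card ≤ B.card → CubeVisible M A B := by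
    intro A hA B hB hle
    obtain ⟨k, hk⟩ := (Nat.modEq_iff_dvd' hle).mp ((hM A hA).trans (hM B hB).symm)
    exact key k A B (hM A hA) (by rw [mul_comm k t]; omega)
  refine isMutualVisibilitySet_of_cubeVisible fun A hA B hB => ?_
  rcases le_total A.card B.card with h | h
  exacts [main A hA B hB h, (main B hB A hA h).symm]

end Hypercube

-- The finite Ramsey theorem.

section Ramsey

/-- Ramsey's theorem for `r`-sets yields large end-homogeneous sets for `(r + 1)`-sets: the colour
of an `(r + 1)`-subset of `T` depends on its least element only. -/
lemma exists_endHomogeneous {q r : ℕ}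
    (hr : ∀ m : ℕ, ∃ N : ℕ, ∀ {α : Type} [LinearOrder α] (c : Finset α → Fin q) (S : Finset α),
      N ≤ S.card → ∃ T ⊆ S, m ≤ T.card ∧ ∃ i, ∀ X ⊆ T, X.card = r → c X = i) (m : ℕ) :
    ∃ N : ℕ, ∀ {α : Type} [LinearOrder α] (c : Finset α → Fin q) (S : Finset α),
      N ≤ S.card → ∃ T ⊆ S, m ≤ T.card ∧ ∃ f : α → Fin q, ∀ a ∈ T, ∀ X ⊆ T, X.card = r →
        (∀ x ∈ X, a < x) → c (insert a X) = f a := by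
  induction m with
  | zero => exact ⟨0, fun c S _ => ⟨∅, by simp, by simp, fun _ => c ∅, by simp⟩⟩
  | succ m ih =>
    obtain ⟨N, hN⟩ := ih
    obtain ⟨N', hN'⟩ := hr N
    refine ⟨N' + 1, fun {α} _ c S hS => ?_⟩
    have hne : S.Nonempty := Finset.card_pos.mp (by omega)
    set a := S.min' hne with ha
    have haS : a ∈ S := S.min'_mem hne
    -- Make the link of the minimum `a` monochromatic, then recurse inside the homogeneous set.
    obtain ⟨S', hS'S, hS'c, i, hi⟩ := hN' (fun X => c (insert a X)) (S.erase a)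
      (by rw [Finset.card_erase_of_mem haS]; omega)
    obtain ⟨T, hTS', hTc, f, hf⟩ := hN c S' hS'c
    have hTS : T ⊆ S.erase a := hTS'.trans hS'S
    have hlt : ∀ x ∈ T, a < x := fun x hx => S.min'_lt_of_mem_erase_min' hne (hTS hx)
    have haT : a ∉ T := fun h => lt_irrefl a (hlt a h)
    refine ⟨insert a T, ?_, by rw [Finset.card_insert_of_notMem haT]; omega,
      Function.update f a i, ?_⟩
    · exact Finset.insert_subset haS (hTS.trans (Finset.erase_subset _ _))
    · intro b hb X hX hXc hbX
      have hab : a ≤ b := by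
        rcases Finset.mem_insert.mp hb with rfl | hb
        exacts [le_rfl, (hlt b hb).le]
      have hXT : X ⊆ T := fun x hx => (Finset.mem_insert.mp (hX hx)).resolve_left
        (hab.trans_lt (hbX x hx)).ne'
      rcases Finset.mem_insert.mp hb with rfl | hb
      · rw [Function.update_self]
        exact hi X (hXT.trans hTS') hXc
      · rw [Function.update_of_ne (hlt b hb).ne']
        exact hf b hb X hXT hXc hbX

/-- The finite Ramsey theorem for `r`-uniform hypergraphs. -/
theorem exists_homogeneous (q r m : ℕ) :
    ∃ N : ℕ, ∀ {α : Type} [LinearOrder α] (c : Finset α → Fin q) (S : Finset α),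
      N ≤ S.card → ∃ T ⊆ S, m ≤ T.card ∧ ∃ i, ∀ X ⊆ T, X.card = r → c X = i := by
  induction r generalizing m with
  | zero =>
    refine ⟨m, fun c S hS => ⟨S, subset_rfl, hS, c ∅, fun X _ hX => ?_⟩⟩
    rw [Finset.card_eq_zero.mp hX]
  | succ r ih =>
    obtain ⟨N, hN⟩ := exists_endHomogeneous ih (q * m)
    refine ⟨N, fun {α} _ c S hS => ?_⟩
    obtain ⟨T, hTS, hTc, f, hf⟩ := hN c S hS
    have hq : Nonempty (Fin q) := ⟨c ∅⟩
    obtain ⟨i, -, hi⟩ := Finset.exists_le_card_fiber_of_mul_le_card_of_maps_to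
      (s := T) (t := Finset.univ) (f := f) (n := m) (fun a _ => Finset.mem_univ _)
      Finset.univ_nonempty (by simpa using hTc)
    refine ⟨T.filter (f · = i), (Finset.filter_subset _ _).trans hTS, hi, i, fun X hX hXc => ?_⟩
    have hne : X.Nonempty := Finset.card_pos.mp (by omega)
    have hmin := X.min'_mem hne
    have h := hf (X.min' hne) (Finset.mem_filter.mp (hX hmin)).1 (X.erase (X.min' hne))
      (((Finset.erase_subset _ _).trans hX).trans (Finset.filter_subset _ _))
      (by rw [Finset.card_erase_of_mem hmin]; omega)
      (fun x hx => X.min'_lt_of_mem_erase_min' hne hx)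
    rw [Finset.insert_erase hmin] at h
    rw [h, (Finset.mem_filter.mp (hX hmin)).2]

/-- Ramsey's theorem for all uniformities below `k` at once. -/
theorem exists_homogeneous_of_card_lt (q k m : ℕ) :
    ∃ N : ℕ, ∀ {α : Type} [LinearOrder α] (c : Finset α → Fin q) (S : Finset α),
      N ≤ S.card → ∃ T ⊆ S, m ≤ T.card ∧
        ∃ f : ℕ → Fin q, ∀ X ⊆ T, X.card < k → c X = f X.card := by
  induction k generalizing m with
  | zero => exact ⟨m, fun c S hS => ⟨S, subset_rfl, hS, fun _ => c ∅, by simp⟩⟩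
  | succ k ih =>
    obtain ⟨N, hN⟩ := exists_homogeneous q k m
    obtain ⟨N', hN'⟩ := ih N
    refine ⟨N', fun {α} _ c S hS => ?_⟩
    obtain ⟨S', hS'S, hS'c, f, hf⟩ := hN' c S hS
    obtain ⟨T, hTS', hTc, i, hi⟩ := hN c S' hS'c
    refine ⟨T, hTS'.trans hS'S, hTc, Function.update f k i, fun X hX hXc => ?_⟩
    rcases Nat.lt_succ_iff_lt_or_eq.mp hXc with h | h
    · rw [Function.update_of_ne h.ne]
      exact hf X (hX.trans hTS') h
    · rw [h, Function.update_self]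
      exact hi X hX h

end Ramsey

-- Unboundedness.

section LowerBound

variable {n : ℕ} {A B : Finset (Fin n)}

/-- Sizes change by at most one along an edge, so a walk meets every layer between its ends. -/
lemma exists_mem_support_card_eq {j : ℕ} (p : (hypercube n).Walk A B) (hA : A.card ≤ j)
    (hB : j ≤ B.card) : ∃ W ∈ p.support, W.card = j := by
  induction p with
  | @nil A => exact ⟨A, by simp, by omega⟩
  | @cons A C B h p ih =>
    rcases hA.eq_or_lt with hA | hA
    · exact ⟨A, by simp, hA⟩
    · have h1 : (symmDiff A C).card = 1 := h
      have h2 : (C \ A).card ≤ 1 := h1 ▸ Finset.card_le_card Finset.subset_union_right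
      have h3 := Finset.le_card_sdiff A C
      obtain ⟨W, hW, hWj⟩ := ih (by omega) hB
      exact ⟨W, by simp [hW], hWj⟩

/-- A point of `W \ B` would have to be added and later removed, making the walk too long. -/
lemma subset_of_mem_support_of_length_eq_dist (hAB : A ⊆ B) (p : (hypercube n).Walk A B)
    (hp : p.length = (hypercube n).dist A B) {W : Finset (Fin n)} (hW : W ∈ p.support) :
    W ⊆ B := by
  obtain ⟨q, r, rfl⟩ := SimpleGraph.Walk.mem_support_iff_exists_append.mp hW
  rw [hypercube_dist, SimpleGraph.Walk.length_append] at hp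
  have hq := card_symmDiff_le_length q
  have hr := card_symmDiff_le_length r
  intro x hx
  by_contra hxB
  have hsub : symmDiff A B ⊆ symmDiff A W ∪ symmDiff W B := symmDiff_triangle A W B
  have hlt : symmDiff A B ⊂ symmDiff A W ∪ symmDiff W B := by
    refine Finset.ssubset_iff_subset_ne.mpr ⟨hsub, fun h => ?_⟩
    have hxm : x ∈ symmDiff A W ∪ symmDiff W B := by simp [Finset.mem_symmDiff, hx, hxB]
    rw [← h, Finset.mem_symmDiff] at hxm
    exact hxm.elim (fun h => hxB (hAB h.1)) (fun h => hxB h.1)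
  have h1 := Finset.card_lt_card hlt
  have h2 := Finset.card_union_le (symmDiff A W) (symmDiff W B)
  omega

theorem exists_forall_not_mutualVisibilityColorable (q : ℕ) :
    ∃ N : ℕ, ∀ n ≥ N, ¬ (hypercube n).MutualVisibilityColorable q := by
  obtain ⟨N, hN⟩ := exists_homogeneous_of_card_lt q (q * 2 + 1) (q * 2 + 1)
  refine ⟨N, fun n hn => ?_⟩
  rintro ⟨c, hc⟩
  obtain ⟨T, -, hT, f, hf⟩ := hN c Finset.univ (by simpa using hn)
  -- The `2q + 1` sizes `0, ..., 2q` get `q` colours, so some colour occurs at three sizes.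
  obtain ⟨a, -, ha⟩ := Finset.exists_lt_card_fiber_of_mul_lt_card_of_maps_to
    (s := Finset.range (q * 2 + 1)) (t := Finset.univ) (f := f) (n := 2)
    (fun a _ => Finset.mem_univ _) (by simp)
  obtain ⟨i, j, l, hij, hjl, hi, hj, hl⟩ : ∃ i j l : ℕ, i < j ∧ j < l ∧
      (i < q * 2 + 1 ∧ f i = a) ∧ (j < q * 2 + 1 ∧ f j = a) ∧ (l < q * 2 + 1 ∧ f l = a) := by
    obtain ⟨x, y, z, hx, hy, hz, hxy, hxz, hyz⟩ := Finset.two_lt_card_iff.mp ha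
    simp only [Finset.mem_filter, Finset.mem_range] at hx hy hz
    rcases hxy.lt_or_gt with h1 | h1 <;> rcases hxz.lt_or_gt with h2 | h2 <;>
      rcases hyz.lt_or_gt with h3 | h3
    exacts [⟨x, y, z, h1, h3, hx, hy, hz⟩, ⟨x, z, y, h2, h3, hx, hz, hy⟩, by omega,
      ⟨z, x, y, h2, h1, hz, hx, hy⟩, ⟨y, x, z, h1, h2, hy, hx, hz⟩, by omega,
      ⟨y, z, x, h3, h2, hy, hz, hx⟩, ⟨z, y, x, h3, h1, hz, hy, hx⟩]
  obtain ⟨B, hBT, hB⟩ := Finset.exists_subset_card_eq (s := T) (n := l) (by omega)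
  obtain ⟨A, hAB, hA⟩ := Finset.exists_subset_card_eq (s := B) (n := i) (by omega)
  have hcol : ∀ X ⊆ B, X.card < q * 2 + 1 ∧ f X.card = a → c X = a := fun X hX h =>
    (hf X (hX.trans hBT) h.1).trans h.2
  obtain ⟨p, -, hp, hpM⟩ := hc a A (hcol A hAB (hA ▸ hi)) B (hcol B subset_rfl (hB ▸ hl))
  obtain ⟨W, hW, hWj⟩ := exists_mem_support_card_eq p (hA.trans_le hij.le) (hjl.le.trans_eq hB.symm)
  refine hpM W hW ?_ ?_ (hcol W (subset_of_mem_support_of_length_eq_dist hAB p hp hW) (hWj ▸ hj))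
  · rintro rfl; omega
  · rintro rfl; omega

lemma SimpleGraph.MutualVisibilityColorable.mono {V : Type*} {G : SimpleGraph V} {q q' : ℕ}
    (h : G.MutualVisibilityColorable q) (hq : q ≤ q') : G.MutualVisibilityColorable q' := by
  obtain ⟨c, hc⟩ := h
  refine ⟨fun v => Fin.castLE hq (c v), fun i u hu v hv => ?_⟩
  obtain ⟨p, hp, hd, hM⟩ := hc (c u) u rfl v
    (Fin.castLE_injective hq (hv.trans (Eq.symm hu)))
  exact ⟨p, hp, hd, fun w hw h1 h2 h3 => hM w hw h1 h2
    (Fin.castLE_injective hq (Eq.trans h3 (Eq.symm hu)))⟩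

theorem tendsto_mutualVisibilityChromaticNumber_hypercube :
    Filter.Tendsto (fun n : ℕ => (hypercube n).mutualVisibilityChromaticNumber)
      Filter.atTop Filter.atTop := by
  refine Filter.tendsto_atTop.mpr fun q => ?_
  obtain ⟨N, hN⟩ := exists_forall_not_mutualVisibilityColorable q
  filter_upwards [Filter.eventually_ge_atTop N] with n hn
  by_contra! h
  exact hN n hn ((hypercube n).mutualVisibilityColorable_chromaticNumber.mono h.le)

end LowerBound

-- The `log log` bound.

section UpperBound

/-- The union bound for property B: few sets of size at least `N` admit a two-colouring of the
points for which none of them is monochromatic. -/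
lemma exists_bicoloring {ι K : Type*} [Fintype K] [DecidableEq K] (I : Finset ι)
    (F : ι → Finset K) {N : ℕ} (hF : ∀ i ∈ I, N ≤ (F i).card) (hI : I.card * 2 < 2 ^ N) :
    ∃ g : K → Bool, ∀ i ∈ I, ∀ b, ∃ x ∈ F i, g x ≠ b := by
  by_contra! h
  obtain ⟨i₀, hi₀, -⟩ := h fun _ => true
  have hNK : N ≤ Fintype.card K := (hF i₀ hi₀).trans (Finset.card_le_univ _)
  -- `E (i, b)` holds the colourings constantly `b` on `F i`; these would cover all colourings.
  let E : ι × Bool → Finset (K → Bool) := fun e =>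
    Fintype.piFinset fun x => if x ∈ F e.1 then {e.2} else Finset.univ
  have hE : ∀ e ∈ I ×ˢ (Finset.univ : Finset Bool), (E e).card ≤ 2 ^ (Fintype.card K - N) := by
    intro e he
    have hcard : (E e).card = 2 ^ (Fintype.card K - (F e.1).card) := by
      simp only [E, Fintype.card_piFinset, apply_ite Finset.card, Finset.card_singleton,
        Finset.card_univ, Fintype.card_bool, Finset.prod_ite, Finset.prod_const_one, one_mul,
        Finset.prod_const]
      congr 1
      rw [← Finset.card_compl]
      congr 1
      ext x
      simp
    rw [hcard]
    exact Nat.pow_le_pow_right (by norm_num)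
      (Nat.sub_le_sub_left (hF _ (Finset.mem_product.mp he).1) _)
  have hcov : (Finset.univ : Finset (K → Bool)) ⊆
      (I ×ˢ (Finset.univ : Finset Bool)).biUnion E := by
    intro g _
    obtain ⟨i, hi, b, hb⟩ := h g
    refine Finset.mem_biUnion.mpr ⟨(i, b), by simp [hi], ?_⟩
    rw [Fintype.mem_piFinset]
    intro x
    by_cases hx : x ∈ F i <;> simp [hx, hb]
  have h1 := (Finset.card_le_card hcov).trans (Finset.card_biUnion_le_card_mul _ _ _ hE)
  rw [Finset.card_univ, Fintype.card_fun, Fintype.card_bool, Finset.card_product,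
    Finset.card_univ, Fintype.card_bool] at h1
  have h2 : I.card * 2 * 2 ^ (Fintype.card K - N) < 2 ^ N * 2 ^ (Fintype.card K - N) :=
    Nat.mul_lt_mul_of_pos_right hI (by positivity)
  rw [← pow_add, Nat.add_sub_cancel' hNK] at h2
  omega

/-- A set of `t` points is determined among the sets of its size by its power sums of exponents
below `2 * t`. -/
lemma eq_of_sum_pow_eq {R ι : Type*} [CommRing R] [IsDomain R] [DecidableEq ι] {v : ι → R}
    (hv : Function.Injective v) {t : ℕ} {S T : Finset ι} (hS : S.card = t) (hT : T.card = t)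
    (h : ∀ j < 2 * t, ∑ i ∈ S, v i ^ j = ∑ i ∈ T, v i ^ j) : S = T := by
  by_contra hne
  obtain ⟨x, hxS, hxT⟩ : ∃ x ∈ S, x ∉ T := by
    by_contra! hST
    exact hne (Finset.eq_of_subset_of_card_le hST (by omega))
  -- `P` vanishes on `S ∪ T` except at `x`, so its sum is `P(x) ≠ 0` over `S` but `0` over `T`; its
  -- degree is below `2t`, so equal power sums forbid this.
  let P : Polynomial R := ∏ j ∈ (S ∪ T).erase x, (Polynomial.X - Polynomial.C (v j))
  have hdeg : P.natDegree < 2 * t := by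
    have h1 : P.natDegree = ((S ∪ T).erase x).card := by
      simp only [P, Polynomial.natDegree_finsetProd_X_sub_C_eq_card]
    have h2 := Finset.card_erase_lt_of_mem (Finset.mem_union_left T hxS)
    have h3 := Finset.card_union_le S T
    omega
  have hsum : ∑ i ∈ S, P.eval (v i) = ∑ i ∈ T, P.eval (v i) := by
    simp_rw [Polynomial.eval_eq_sum_range' hdeg]
    rw [Finset.sum_comm, Finset.sum_comm (s := T)]
    refine Finset.sum_congr rfl fun j hj => ?_
    rw [← Finset.mul_sum, ← Finset.mul_sum, h j (Finset.mem_range.mp hj)]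
  have hzero : ∀ i ∈ S ∪ T, i ≠ x → P.eval (v i) = 0 := by
    intro i hi hix
    simp only [P, Polynomial.eval_prod]
    exact Finset.prod_eq_zero (Finset.mem_erase.mpr ⟨hix, hi⟩) (by simp)
  rw [Finset.sum_eq_single_of_mem x hxS
      fun i hi hix => hzero i (Finset.mem_union_left T hi) hix,
    Finset.sum_eq_zero fun i hi => hzero i (Finset.mem_union_right S hi)
      (fun hix => hxT (hix ▸ hi))] at hsum
  simp only [P, Polynomial.eval_prod, Finset.prod_eq_zero_iff] at hsum
  obtain ⟨j, hj, hxj⟩ := hsum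
  simp only [Polynomial.eval_sub, Polynomial.eval_X, Polynomial.eval_C, sub_eq_zero] at hxj
  exact (Finset.mem_erase.mp hj).1 (hv hxj).symm

/-- If `t` is large enough in terms of `n`, the vertices of the cube have a two-colouring such that
the middle layer between nested vertices `2 * t` layers apart is never monochromatic. -/
lemma exists_bicoloring_middle {n t : ℕ} (hn : n ≠ 0)
    (ht : (2 * n) ^ (2 * t) * n ^ (2 * t) * 2 < 2 ^ t.centralBinom) :
    ∃ g : Finset (Fin n) → Bool, ∀ A B : Finset (Fin n), A ⊆ B → B.card = A.card + 2 * t →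
      ∀ b, ∃ X, A ⊆ X ∧ X ⊆ B ∧ X.card = A.card + t ∧ g X ≠ b := by
  -- `p > n` keeps the points distinct mod `p`; `p ≤ 2n` bounds the number of vectors.
  obtain ⟨p, hp, hnp, hp2⟩ := Nat.exists_prime_lt_and_le_two_mul n hn
  have : Fact p.Prime := ⟨hp⟩
  let v : Fin n → ZMod p := fun i => ((i : ℕ) : ZMod p)
  have hv : Function.Injective v := by
    intro i j hij
    have := (ZMod.natCast_eq_natCast_iff' _ _ _).mp hij
    rw [Nat.mod_eq_of_lt (i.2.trans hnp), Nat.mod_eq_of_lt (j.2.trans hnp)] at this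
    exact Fin.ext this
  let s : Finset (Fin n) → Fin (2 * t) → ZMod p := fun X j => ∑ i ∈ X, v i ^ (j : ℕ)
  have hs : ∀ S T : Finset (Fin n), S.card = t → T.card = t → s S = s T → S = T :=
    fun S T hS hT h => eq_of_sum_pow_eq hv hS hT fun j hj => congrFun h ⟨j, hj⟩
  -- For `e = (s A, B \ A)` these are the vectors of the middle layer; `A` enters only through `s
  -- A`.
  let F : (Fin (2 * t) → ZMod p) × Finset (Fin n) → Finset (Fin (2 * t) → ZMod p) := fun e =>
    (e.2.powersetCard t).image fun T => e.1 + s T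
  obtain ⟨g, hg⟩ := exists_bicoloring (Finset.univ ×ˢ Finset.univ.powersetCard (2 * t)) F
    (N := t.centralBinom) (by
      rintro ⟨k, D⟩ he
      have hD := (Finset.mem_powersetCard.mp (Finset.mem_product.mp he).2).2
      simp only [F]
      rw [Finset.card_image_of_injOn, Finset.card_powersetCard, hD, Nat.centralBinom]
      intro S hS T hT hST
      exact hs S T (Finset.mem_powersetCard.mp hS).2 (Finset.mem_powersetCard.mp hT).2
        (add_left_cancel hST)) (by
      refine lt_of_le_of_lt ?_ ht
      rw [Finset.card_product, Finset.card_univ, Fintype.card_fun, ZMod.card, Fintype.card_fin,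
        Finset.card_powersetCard, Finset.card_univ, Fintype.card_fin]
      gcongr
      exact Nat.choose_le_pow n (2 * t))
  refine ⟨fun X => g (s X), fun A B hAB hB b => ?_⟩
  obtain ⟨x, hx, hxb⟩ := hg (s A, B \ A) (by
    simp [Finset.card_sdiff_of_subset hAB, hB]) b
  obtain ⟨T, hT, rfl⟩ := Finset.mem_image.mp hx
  obtain ⟨hTB, hTc⟩ := Finset.mem_powersetCard.mp hT
  have hdisj : Disjoint A T := Finset.disjoint_of_subset_right hTB Finset.disjoint_sdiff
  refine ⟨A ∪ T, Finset.subset_union_left, Finset.union_subset hAB (hTB.trans Finset.sdiff_subset),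
    by rw [Finset.card_union_of_disjoint hdisj, hTc], ?_⟩
  have hsum : s (A ∪ T) = s A + s T := by
    ext j
    exact Finset.sum_union hdisj
  simpa only [hsum] using hxb

lemma SimpleGraph.mutualVisibilityColorable_of_fintype {V κ : Type*} [Fintype κ]
    {G : SimpleGraph V} (c : V → κ) (hc : ∀ i, G.IsMutualVisibilitySet {v | c v = i}) :
    G.MutualVisibilityColorable (Fintype.card κ) := by
  refine ⟨fun v => Fintype.equivFin κ (c v), fun i => ?_⟩
  have h : {v | Fintype.equivFin κ (c v) = i} = {v | c v = (Fintype.equivFin κ).symm i} := by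
    ext v
    simp [Equiv.eq_symm_apply]
  rw [h]
  exact hc _

lemma mutualVisibilityChromaticNumber_hypercube_le {n t : ℕ} (hn : n ≠ 0) (ht3 : 3 ≤ t)
    (ht : (2 * n) ^ (2 * t) * n ^ (2 * t) * 2 < 2 ^ t.centralBinom) :
    (hypercube n).mutualVisibilityChromaticNumber ≤ t * 2 := by
  obtain ⟨g, hg⟩ := exists_bicoloring_middle hn ht
  have hpos : 0 < t := by omega
  have hcol : (hypercube n).MutualVisibilityColorable (Fintype.card (Fin t × Bool)) := by
    refine SimpleGraph.mutualVisibilityColorable_of_fintype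
      (fun X => ((⟨X.card % t, Nat.mod_lt _ hpos⟩ : Fin t), g X)) ?_
    rintro ⟨r, b⟩
    refine isMutualVisibilitySet_of_middle (r := r) ht3 (fun W hW => ?_)
      fun A B hAB hB _ => ?_
    · exact congrArg Fin.val (congrArg Prod.fst hW)
    · obtain ⟨X, h1, h2, h3, h4⟩ := hg A B hAB hB b
      exact ⟨X, h1, h2, h3, fun h => h4 (congrArg Prod.snd h)⟩
  rw [Fintype.card_prod, Fintype.card_fin, Fintype.card_bool] at hcol
  exact Nat.sInf_le hcol

lemma sq_le_two_pow {t : ℕ} (ht : 4 ≤ t) : t ^ 2 ≤ 2 ^ t := by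
  induction t, ht using Nat.le_induction with
  | base => norm_num
  | succ t ht ih => rw [pow_succ 2]; nlinarith

/-- With `t = s + 10`, the left exponent is at most `7t * 2^s`, while `centralBinom t ≥ 4^t / (2t)`
and `4^t = 2^s * 2^10 * 2^t`; the `10` beats the factor `14`. -/
lemma pow_mul_pow_lt_two_pow_centralBinom {n l s : ℕ} (hn : n ≤ 2 ^ l) (hl : l ≤ 2 ^ s) :
    (2 * n) ^ (2 * (s + 10)) * n ^ (2 * (s + 10)) * 2 < 2 ^ (s + 10).centralBinom := by
  obtain ⟨t, hts⟩ : ∃ t, t = s + 10 := ⟨_, rfl⟩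
  rw [← hts]
  have h1 : (2 * n) ^ (2 * t) * n ^ (2 * t) * 2 ≤
      (2 * 2 ^ l) ^ (2 * t) * (2 ^ l) ^ (2 * t) * 2 := by gcongr
  refine h1.trans_lt ?_
  have h2 : (2 * 2 ^ l) ^ (2 * t) * (2 ^ l) ^ (2 * t) * 2 = 2 ^ (4 * t * l + 2 * t + 1) := by
    rw [← pow_succ', ← pow_mul, ← pow_mul, ← pow_add, ← pow_succ]
    congr 1
    ring
  rw [h2]
  refine Nat.pow_lt_pow_right (by norm_num) ?_
  refine lt_of_mul_lt_mul_left (a := 2 * t) ?_ (Nat.zero_le _)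
  refine lt_of_lt_of_le ?_ (Nat.four_pow_le_two_mul_self_mul_centralBinom t (by omega))
  have h3 : 4 ^ t = 2 ^ s * 2 ^ 10 * 2 ^ t := by
    rw [← pow_add, ← hts, ← mul_pow]; norm_num
  have h4 : t ^ 2 ≤ 2 ^ t := sq_le_two_pow (by omega)
  have h5 : 1 ≤ 2 ^ s := Nat.one_le_two_pow
  have h6 : 10 ≤ t := by omega
  calc 2 * t * (4 * t * l + 2 * t + 1)
      ≤ 2 * t * (4 * t * 2 ^ s + 2 * t * 2 ^ s + t * 2 ^ s) := by
        have h7 : 2 * t ≤ 2 * t * 2 ^ s := Nat.le_mul_of_pos_right _ h5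
        have h8 : 1 ≤ t * 2 ^ s := Nat.mul_pos (by omega) h5
        exact Nat.mul_le_mul_left _ (add_le_add (add_le_add (Nat.mul_le_mul_left _ hl) h7) h8)
    _ = 14 * (2 ^ s * t ^ 2) := by ring
    _ ≤ 14 * (2 ^ s * 2 ^ t) := by gcongr
    _ < 2 ^ s * 2 ^ 10 * 2 ^ t := by
        have : 0 < 2 ^ s * 2 ^ t := by positivity
        nlinarith
    _ = 4 ^ t := h3.symm

lemma mutualVisibilityChromaticNumber_hypercube_le_log_log {n : ℕ} (hn : n ≠ 0) :
    (hypercube n).mutualVisibilityChromaticNumber ≤ 2 * Nat.log 2 (Nat.log 2 n) + 22 := by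
  set l := Nat.log 2 n with hl
  have h1 : n ≤ 2 ^ (l + 1) := (Nat.lt_pow_succ_log_self (by norm_num) n).le
  have h2 : l + 1 ≤ 2 ^ (Nat.log 2 l + 1) := Nat.lt_pow_succ_log_self (by norm_num) l
  have h := mutualVisibilityChromaticNumber_hypercube_le hn (by omega)
    (pow_mul_pow_lt_two_pow_centralBinom h1 h2)
  omega

theorem isBigO_mutualVisibilityChromaticNumber_hypercube :
    (fun n : ℕ => ((hypercube n).mutualVisibilityChromaticNumber : ℝ)) =O[Filter.atTop]
      (fun n : ℕ => Real.logb 2 (Real.logb 2 (n : ℝ))) := by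
  -- `24 = 2 + 22`, since the iterated logarithm is at least `1` once `n ≥ 4`.
  refine Asymptotics.IsBigO.of_bound 24 ?_
  filter_upwards [Filter.eventually_ge_atTop 4] with n hn
  have hn0 : n ≠ 0 := by omega
  have hl2 : 2 ≤ Nat.log 2 n := Nat.le_log_of_pow_le (by norm_num) (by simpa using hn)
  have hs1 : 1 ≤ Nat.log 2 (Nat.log 2 n) := Nat.le_log_of_pow_le (by norm_num) (by simpa using hl2)
  have h1 : (Nat.log 2 n : ℝ) ≤ Real.logb 2 n := by exact_mod_cast Real.natLog_le_logb n 2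
  have h2 : (Nat.log 2 (Nat.log 2 n) : ℝ) ≤ Real.logb 2 (Nat.log 2 n : ℕ) := by
    exact_mod_cast Real.natLog_le_logb (Nat.log 2 n) 2
  have h3 : Real.logb 2 (Nat.log 2 n : ℕ) ≤ Real.logb 2 (Real.logb 2 n) :=
    Real.logb_le_logb_of_le (by norm_num) (by exact_mod_cast (by omega : 0 < Nat.log 2 n)) h1
  have h4 : (1 : ℝ) ≤ Nat.log 2 (Nat.log 2 n) := by exact_mod_cast hs1
  have h5 : ((hypercube n).mutualVisibilityChromaticNumber : ℝ) ≤
      2 * Nat.log 2 (Nat.log 2 n) + 22 := by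
    exact_mod_cast mutualVisibilityChromaticNumber_hypercube_le_log_log hn0
  rw [Real.norm_of_nonneg (Nat.cast_nonneg _), Real.norm_of_nonneg (by linarith)]
  linarith

end UpperBound

theorem theorem2 :
    Filter.Tendsto (fun n : ℕ => (hypercube n).mutualVisibilityChromaticNumber)
        Filter.atTop Filter.atTop ∧
      (fun n : ℕ => ((hypercube n).mutualVisibilityChromaticNumber : ℝ)) =O[Filter.atTop]
        (fun n : ℕ => Real.logb 2 (Real.logb 2 (n : ℝ))) ∧
      ¬ ∃ C : ℝ, 0 < C ∧
        ∀ n : ℕ, ((hypercube n).mutualVisibilityChromaticNumber : ℝ) ≤ C := by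
  refine ⟨tendsto_mutualVisibilityChromaticNumber_hypercube,
    isBigO_mutualVisibilityChromaticNumber_hypercube, ?_⟩
  rintro ⟨C, -, hC⟩
  have h := tendsto_natCast_atTop_atTop (R := ℝ).comp
    tendsto_mutualVisibilityChromaticNumber_hypercube
  obtain ⟨n, hn⟩ := (h.eventually_gt_atTop C).exists
  exact absurd (hC n) (not_le.mpr hn)
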